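/- Let $(\mathcal C,\otimes,\mathbb 1)$ be a monoidal category (associativity and unit constraints are suppressed in the notation). A \emph{comonoidal monad} on $\mathcal C$ is a monad $(T,\mu,\eta)$ together with a comonoidal (oplax monoidal) structure $T_2:T(X\otimes Y)\to TX\otimes TY$, $T_0:T\mathbb 1\to\mathbb 1$ on the functor $T$, such that $\eta$ and $\mu$ are comonoidal natural transformations. It is a \emph{left Hopf monad} if the left fusion operator $$T(X\otimes TY)\xrightarrow{\,T_2\,}TX\otimes T^2Y\xrightarrow{\,1\otimes\mu\,}TX\otimes TY$$ is invertible for all $X,Y$. The unit $\mathbb 1$ is a $T$-algebra via $T_0$, and the tensor product of $T$-algebras $(A,a)$, $(B,b)$ is the $T$-algebra $A\otimes B$ with action $(a\otimes b)\circ T_2$; each $TX$ is regarded as the free $T$-algebra $(TX,\mu_X)$. \textbf{Theorem.} Let $T$ be a left Hopf monad on a monoidal category $\mathcal C$, let $C$ be an object of $\mathcal C$, and let $\bar u:\mathbb 1\to TC$ and $\bar m:T\mathbb 1\otimes TC\to T\mathbb 1$ be morphisms of $T$-algebras such that \begin{enumerate} \item[(i)] $(1\otimes\bar m)\circ(T_2\otimes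 1)=T_2\circ\bar m : T\mathbb 1\otimes TC\to T\mathbb 1\otimes T\mathbb 1$, \item[(ii)] $(\bar m\otimes 1)\circ(1\otimes T_2)=T_2\circ\bar m : T\mathbb 1\otimes TC\to T\mathbb 1\otimes T\mathbb 1$, \item[(iii)] $\bar m\circ(1\otimes\bar u)=1_{T\mathbb 1}$, \item[(iv)] $(1\otimes\bar m)\circ(T_2\otimes 1)\circ(\bar u\otimes 1)=T_2 : TC\to TC\otimes T\mathbb 1$, \end{enumerate} where $T_2$ stands for $T_2:T\mathbb 1=T(\mathbb 1\otimes\mathbb 1)\to T\mathbb 1\otimes T\mathbb 1$ or $T_2:TC=T(C\otimes\mathbb 1)\to TC\otimes T\mathbb 1$. Suppose that $T$ is of descent type, that is, for every object $X$ the diagram $$X\xrightarrow{\ \eta_X\ }TX\underset{\eta_{TX}}{\overset{T\eta_X}{\rightrightarrows}}T^2X$$ is an equaliser, and that $T(1\otimes\eta_X):T(C\otimes X)\to T(C\otimes TX)$ is a monomorphism for every object $X$. Then the functor $T(C\otimes-)$ is right adjoint to $T$. -/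

import Mathlib

namespace HopfMonad

open CategoryTheory MonoidalCategory Functor.OplaxMonoidal

universe v u

variable {C : Type u} [Category.{v} C] [MonoidalCategory C]

/-- A comonoidal monad: the functor part is comonoidal (oplax monoidal, with `T₂ = δ` and
`T₀ = η`), and the unit and multiplication of the monad are comonoidal natural transformations. -/
class IsComonoidal (T : Monad C) [(T : C ⥤ C).OplaxMonoidal] : Prop where
  unit_tensor (X Y : C) :
    T.η.app (X ⊗ Y) ≫ δ (T : C ⥤ C) X Y = T.η.app X ⊗ₘ T.η.app Y
  unit_unit : T.η.app (𝟙_ C) ≫ η (T : C ⥤ C) = 𝟙 (𝟙_ C)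
  mul_tensor (X Y : C) :
    T.μ.app (X ⊗ Y) ≫ δ (T : C ⥤ C) X Y =
      T.map (δ (T : C ⥤ C) X Y) ≫ δ (T : C ⥤ C) (T.obj X) (T.obj Y) ≫
        (T.μ.app X ⊗ₘ T.μ.app Y)
  mul_unit : T.μ.app (𝟙_ C) ≫ η (T : C ⥤ C) = T.map (η (T : C ⥤ C)) ≫ η (T : C ⥤ C)

/-- The left fusion operator `T(X ⊗ TY) ⟶ TX ⊗ TTY ⟶ TX ⊗ TY`. -/
def leftFusion (T : Monad C) [(T : C ⥤ C).OplaxMonoidal] (X Y : C) :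
    T.obj (X ⊗ T.obj Y) ⟶ T.obj X ⊗ T.obj Y :=
  δ (T : C ⥤ C) X (T.obj Y) ≫ T.obj X ◁ T.μ.app Y

/-- A left Hopf monad: a comonoidal monad whose left fusion operator is invertible. -/
class IsLeftHopf (T : Monad C) [(T : C ⥤ C).OplaxMonoidal] : Prop extends IsComonoidal T where
  isIso_leftFusion (X Y : C) : IsIso (leftFusion T X Y)

/-- The unit object of the monoidal category of `T`-algebras: `𝟙_ C` with action `T₀`. -/
def unitAlgebra (T : Monad C) [(T : C ⥤ C).OplaxMonoidal] [IsComonoidal T] : T.Algebra where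
  A := 𝟙_ C
  a := η (T : C ⥤ C)
  unit := IsComonoidal.unit_unit
  assoc := IsComonoidal.mul_unit

/-- The tensor product of `T`-algebras: `A ⊗ B` with action
`T(A ⊗ B) ⟶ TA ⊗ TB ⟶ A ⊗ B`. -/
def tensorAlgebra {T : Monad C} [(T : C ⥤ C).OplaxMonoidal] [IsComonoidal T]
    (A B : T.Algebra) : T.Algebra where
  A := A.A ⊗ B.A
  a := δ (T : C ⥤ C) A.A B.A ≫ (A.a ⊗ₘ B.a)
  unit := by
    rw [← Category.assoc, IsComonoidal.unit_tensor, tensorHom_comp_tensorHom, A.unit, B.unit]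
    exact id_tensorHom_id _ _
  assoc := by
    rw [← Category.assoc, IsComonoidal.mul_tensor, Functor.map_comp, Category.assoc,
      Category.assoc, Category.assoc, tensorHom_comp_tensorHom, A.assoc, B.assoc,
      ← tensorHom_comp_tensorHom, δ_natural_assoc]

/-- `T₂ : TX ≅ T(X ⊗ 𝟙) ⟶ TX ⊗ T𝟙`. -/
def coact (T : Monad C) [(T : C ⥤ C).OplaxMonoidal] (X : C) :
    T.obj X ⟶ T.obj X ⊗ T.obj (𝟙_ C) :=
  T.map (ρ_ X).inv ≫ δ (T : C ⥤ C) X (𝟙_ C)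

/-- The four compatibility relations between `u : 𝟙 ⟶ TK` and `m : T𝟙 ⊗ TK ⟶ T𝟙`. -/
structure LC (T : Monad C) [(T : C ⥤ C).OplaxMonoidal] (K : C)
    (u : 𝟙_ C ⟶ T.obj K) (m : T.obj (𝟙_ C) ⊗ T.obj K ⟶ T.obj (𝟙_ C)) : Prop where
  i : coact T (𝟙_ C) ▷ T.obj K ≫ (α_ _ _ _).hom ≫ T.obj (𝟙_ C) ◁ m = m ≫ coact T (𝟙_ C)
  ii : T.obj (𝟙_ C) ◁ coact T K ≫ (α_ _ _ _).inv ≫ m ▷ T.obj (𝟙_ C) = m ≫ coact T (𝟙_ C)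
  iii : (ρ_ (T.obj (𝟙_ C))).inv ≫ T.obj (𝟙_ C) ◁ u ≫ m = 𝟙 (T.obj (𝟙_ C))
  iv : (λ_ (T.obj K)).inv ≫ u ▷ T.obj K ≫ coact T K ▷ T.obj K ≫ (α_ _ _ _).hom ≫
      T.obj K ◁ m = coact T K

/-- A monad is of descent type if `X ⟶ TX ⇉ TTX` is an equaliser for every `X`, where the
parallel pair is `T(η_X), η_(TX)`. -/
def IsOfDescentType (T : Monad C) : Prop :=
  ∀ X : C, Nonempty (Limits.IsLimit
    (Limits.Fork.ofι (P := X) (f := T.map (T.η.app X)) (g := T.η.app (T.obj X)) (T.η.app X)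
      (T.η.naturality (T.η.app X)).symm))

end HopfMonad

namespace HopfMonad

open CategoryTheory MonoidalCategory Functor.OplaxMonoidal

universe v u

variable {C : Type u} [Category.{v} C] [MonoidalCategory C]

/-! ### Comonoidal monads: fusion operators and coaction of `T𝟙` -/

section Comonoidal

variable (T : Monad C) [(T : C ⥤ C).OplaxMonoidal]

/-! The pair `u`, `m` is a duality in disguise. Restricting `m` along the unit of `T` and applying
`T₀` gives a form on `TK`, hence a contraction `T(K ⊗ Y) ⟶ TY`. Relations (i) and (ii) show that it
equalises `T(η_Y)` and `η_(TY)` after the invertible fusion operator; descent then factors it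
through a map `r : T(K ⊗ Y) ⟶ Y` (`LC.exists_evaluation`). The counit is `μ` followed by `r`. In the
other direction `u` and the inverse fusion operator give `TX ⟶ TK ⊗ TX ≅ T(K ⊗ TX)`, and
precomposing with `η_X` gives the unit. One triangle identity comes from (iii), as `u` paired with
the form is the identity. The other comes from (iv) and is checked after the monomorphism `T(K ⊗
η_Y)`. -/

theorem coact_counit (X : C) :
    coact T X ≫ T.obj X ◁ η (T : C ⥤ C) = (ρ_ (T.obj X)).inv := by
  simp [coact, right_unitality]

theorem coact_one_counit :
    coact T (𝟙_ C) ≫ η (T : C ⥤ C) ▷ T.obj (𝟙_ C) = (λ_ (T.obj (𝟙_ C))).inv := by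
  rw [coact, left_unitality, unitors_inv_equal, Category.assoc]

/-- Coassociativity of `T₂`, with the unit object in the middle. -/
theorem comul_coassoc_one (X Y : C) :
    δ (T : C ⥤ C) X Y ≫ T.obj X ◁ (T.map (λ_ Y).inv ≫ δ (T : C ⥤ C) (𝟙_ C) Y) =
      δ (T : C ⥤ C) X Y ≫ coact T X ▷ T.obj Y ≫ (α_ _ _ _).hom := by
  have h := associativity (F := (T : C ⥤ C)) X (𝟙_ C) Y
  rw [coact, comp_whiskerRight, Category.assoc, δ_natural_left_assoc, h,
    MonoidalCategory.whiskerLeft_comp, δ_natural_right_assoc, ← Functor.map_comp_assoc]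
  simp

/-- The fusion operator `T(X ⊗ B) ⟶ TX ⊗ B` at an action `b : TB ⟶ B`. -/
def fusion (X : C) {B : C} (b : T.obj B ⟶ B) : T.obj (X ⊗ B) ⟶ T.obj X ⊗ B :=
  δ (T : C ⥤ C) X B ≫ T.obj X ◁ b

/-- The fusion operator at the unit object, `TB ≅ T(𝟙 ⊗ B) ⟶ T𝟙 ⊗ B`. -/
def unitFusion {B : C} (b : T.obj B ⟶ B) : T.obj B ⟶ T.obj (𝟙_ C) ⊗ B :=
  T.map (λ_ B).inv ≫ fusion T (𝟙_ C) b

/-- The action `T(A ⊗ B) ⟶ TA ⊗ TB ⟶ A ⊗ B` on a tensor product. -/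
def tensorAction {A B : C} (a : T.obj A ⟶ A) (b : T.obj B ⟶ B) : T.obj (A ⊗ B) ⟶ A ⊗ B :=
  δ (T : C ⥤ C) A B ≫ (a ⊗ₘ b)

variable {T}

theorem fusion_natural_left {X Y B : C} (f : X ⟶ Y) (b : T.obj B ⟶ B) :
    T.map (f ▷ B) ≫ fusion T Y b = fusion T X b ≫ T.map f ▷ B := by
  rw [fusion, fusion, ← δ_natural_left_assoc, Category.assoc, whisker_exchange]

theorem fusion_natural_right (X : C) {A B : C} {a : T.obj A ⟶ A} {b : T.obj B ⟶ B} {f : A ⟶ B}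
    (h : T.map f ≫ b = a ≫ f) :
    T.map (X ◁ f) ≫ fusion T X b = fusion T X a ≫ T.obj X ◁ f := by
  rw [fusion, fusion, ← δ_natural_right_assoc, Category.assoc, ← MonoidalCategory.whiskerLeft_comp,
    ← MonoidalCategory.whiskerLeft_comp, h]

theorem unitFusion_natural {A B : C} {a : T.obj A ⟶ A} {b : T.obj B ⟶ B} {f : A ⟶ B}
    (h : T.map f ≫ b = a ≫ f) :
    T.map f ≫ unitFusion T b = unitFusion T a ≫ T.obj (𝟙_ C) ◁ f := by
  rw [unitFusion, unitFusion, Category.assoc, ← fusion_natural_right _ h,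
    ← Functor.map_comp_assoc, ← Functor.map_comp_assoc, leftUnitor_inv_naturality]

theorem unitFusion_counit {B : C} (b : T.obj B ⟶ B) :
    unitFusion T b ≫ η (T : C ⥤ C) ▷ B = b ≫ (λ_ B).inv := by
  rw [unitFusion, fusion, Category.assoc, Category.assoc, whisker_exchange,
    leftUnitor_inv_naturality, left_unitality]
  simp only [Category.assoc]

theorem comul_unitFusion (X : C) {B : C} (b : T.obj B ⟶ B) :
    δ (T : C ⥤ C) X B ≫ T.obj X ◁ unitFusion T b =
      fusion T X b ≫ coact T X ▷ B ≫ (α_ _ _ _).hom := by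
  have h := comul_coassoc_one T X B
  rw [unitFusion, fusion, ← Category.assoc (T.map _), MonoidalCategory.whiskerLeft_comp,
    reassoc_of% h, fusion, Category.assoc, whisker_exchange_assoc]
  simp

theorem map_unit_fusion (X Y : C) :
    T.map (X ◁ T.η.app Y) ≫ fusion T X (T.μ.app Y) = δ (T : C ⥤ C) X Y := by
  rw [fusion, ← δ_natural_right_assoc, ← MonoidalCategory.whiskerLeft_comp, T.right_unit]
  simp

theorem map_unit_unitFusion (Y : C) :
    T.map (T.η.app Y) ≫ unitFusion T (T.μ.app Y) =
      T.map (λ_ Y).inv ≫ δ (T : C ⥤ C) (𝟙_ C) Y := by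
  rw [unitFusion, ← Functor.map_comp_assoc, leftUnitor_inv_naturality, Functor.map_comp_assoc,
    map_unit_fusion]
  simp

/-- Coassociativity of `T₂`: fusing with a tensor product can be done one factor at a time. -/
theorem unitFusion_tensorAction {A B : C} (a : T.obj A ⟶ A) (b : T.obj B ⟶ B) :
    unitFusion T (tensorAction T a b) =
      fusion T A b ≫ unitFusion T a ▷ B ≫ (α_ _ _ _).hom := by
  have h := associativity (F := (T : C ⥤ C)) (𝟙_ C) A B
  have e : T.map (λ_ (A ⊗ B)).inv =
      T.map ((λ_ A).inv ▷ B) ≫ T.map (α_ (𝟙_ C) A B).hom := by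
    rw [← Functor.map_comp]; simp
  rw [unitFusion, fusion, tensorAction, e, Category.assoc, MonoidalCategory.whiskerLeft_comp,
    ← reassoc_of% h, unitFusion, fusion, fusion, ← δ_natural_left_assoc, Category.assoc,
    MonoidalCategory.tensorHom_def']
  simp only [comp_whiskerRight, MonoidalCategory.whiskerLeft_comp, Category.assoc,
    whisker_exchange_assoc, tensor_whiskerLeft, whisker_assoc, Iso.inv_hom_id,
    Iso.inv_hom_id_assoc, Category.comp_id]

variable [IsComonoidal T]

theorem unit_unitFusion {B : C} {b : T.obj B ⟶ B} (h : T.η.app B ≫ b = 𝟙 B) :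
    T.η.app B ≫ unitFusion T b = (λ_ B).inv ≫ T.η.app (𝟙_ C) ▷ B := by
  have e := T.η.naturality (λ_ B).inv
  have e' := IsComonoidal.unit_tensor (T := T) (𝟙_ C) B
  dsimp at e h
  rw [unitFusion, fusion, ← reassoc_of% e, reassoc_of% e', MonoidalCategory.tensorHom_def,
    Category.assoc, ← MonoidalCategory.whiskerLeft_comp]
  simp [h]

theorem unit_coact :
    T.η.app (𝟙_ C) ≫ coact T (𝟙_ C) =
      (ρ_ (𝟙_ C)).inv ≫ (T.η.app (𝟙_ C) ⊗ₘ T.η.app (𝟙_ C)) := by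
  have e := T.η.naturality (ρ_ (𝟙_ C)).inv
  have e' := IsComonoidal.unit_tensor (T := T) (𝟙_ C) (𝟙_ C)
  dsimp at e
  rw [coact, ← reassoc_of% e, e']

theorem map_comul_tensorAction (X Y : C) :
    T.map (δ (T : C ⥤ C) X Y) ≫ tensorAction T (T.μ.app X) (T.μ.app Y) =
      T.μ.app (X ⊗ Y) ≫ δ (T : C ⥤ C) X Y :=
  (IsComonoidal.mul_tensor X Y).symm

theorem map_fusion_tensorAction (X : C) {B : C} {b : T.obj B ⟶ B}
    (h : T.map b ≫ b = T.μ.app B ≫ b) :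
    T.map (fusion T X b) ≫ tensorAction T (T.μ.app X) b = T.μ.app _ ≫ fusion T X b := by
  have e := IsComonoidal.mul_tensor (T := T) X B
  rw [fusion, reassoc_of% e, Functor.map_comp, Category.assoc, tensorAction,
    ← δ_natural_right_assoc]
  simp only [← id_tensorHom, tensorHom_comp_tensorHom, h, Category.id_comp,
    Category.comp_id]

end Comonoidal

/-! ### The form on `TK` and its contraction -/

section Pairing

variable {T : Monad C} [(T : C ⥤ C).OplaxMonoidal] {K : C}

/-- The form `TK ⟶ T𝟙 ⊗ TK ⟶ T𝟙 ⟶ 𝟙` induced by `m : T𝟙 ⊗ TK ⟶ T𝟙`. -/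
def form (m : T.obj (𝟙_ C) ⊗ T.obj K ⟶ T.obj (𝟙_ C)) : T.obj K ⟶ 𝟙_ C :=
  (λ_ (T.obj K)).inv ≫ T.η.app (𝟙_ C) ▷ T.obj K ≫ m ≫ η (T : C ⥤ C)

/-- The contraction `T(K ⊗ Y) ⟶ TK ⊗ TY ⟶ TY` with the form induced by `m`. -/
def contraction (m : T.obj (𝟙_ C) ⊗ T.obj K ⟶ T.obj (𝟙_ C)) (Y : C) :
    T.obj (K ⊗ Y) ⟶ T.obj Y :=
  δ (T : C ⥤ C) K Y ≫ form m ▷ T.obj Y ≫ (λ_ (T.obj Y)).hom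

theorem contraction_natural (m : T.obj (𝟙_ C) ⊗ T.obj K ⟶ T.obj (𝟙_ C)) {X Y : C} (f : X ⟶ Y) :
    T.map (K ◁ f) ≫ contraction m Y = contraction m X ≫ T.map f := by
  rw [contraction, contraction, ← δ_natural_right_assoc, whisker_exchange_assoc]
  simp

variable {u : 𝟙_ C ⟶ T.obj K} {m : T.obj (𝟙_ C) ⊗ T.obj K ⟶ T.obj (𝟙_ C)}

/-- Relation (iv) followed by `T₀` on the last factor says that `u` and `m` cancel to the identity
of `TK`; this is that identity tensored with `TY`, precomposed with `T₂`. -/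
theorem LC.tensor_coact_form (h : LC T K u m) (Y : C) :
    (λ_ (T.obj (K ⊗ Y))).inv ≫ u ▷ T.obj (K ⊗ Y) ≫ coact T K ▷ T.obj (K ⊗ Y) ≫
      (α_ _ _ _).hom ≫ T.obj K ◁ (T.obj (𝟙_ C) ◁ δ (T : C ⥤ C) K Y ≫
        (α_ _ _ _).inv ≫ (m ≫ η (T : C ⥤ C)) ▷ T.obj Y ≫ (λ_ _).hom) =
      δ (T : C ⥤ C) K Y := by
  have h₄ := h.iv =≫ (T.obj K ◁ η (T : C ⥤ C) ≫ (ρ_ _).hom)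
  rw [Category.assoc, reassoc_of% coact_counit T K, Iso.inv_hom_id] at h₄
  have h₅ := congrArg (fun f => f ▷ T.obj Y) h₄
  simp only [comp_whiskerRight, Category.assoc, id_whiskerRight] at h₅
  calc
    _ = δ (T : C ⥤ C) K Y ≫ (λ_ (T.obj K ⊗ T.obj Y)).inv ≫ u ▷ (T.obj K ⊗ T.obj Y) ≫
          coact T K ▷ (T.obj K ⊗ T.obj Y) ≫ (α_ _ _ _).hom ≫
          T.obj K ◁ ((α_ _ _ _).inv ≫ (m ≫ η (T : C ⥤ C)) ▷ T.obj Y ≫ (λ_ _).hom) := by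
      rw [leftUnitor_inv_naturality_assoc, whisker_exchange_assoc, whisker_exchange_assoc,
        tensor_whiskerLeft]
      simp
    _ = _ := by
      conv_rhs => rw [← Category.comp_id (δ (T : C ⥤ C) K Y), ← h₅]
      simp [-left_unitality]

variable [IsComonoidal T]

/-- `η_𝟙` is grouplike and (i) makes `m` compatible with the left coaction; applying `T₀` to the
right factor leaves the claim. -/
theorem LC.form_unit (h : LC T K u m) :
    form m ≫ T.η.app (𝟙_ C) = (λ_ (T.obj K)).inv ≫ T.η.app (𝟙_ C) ▷ T.obj K ≫ m := by
  have hi := h.i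
  have hc := coact_counit T (𝟙_ C)
  have hu := unit_coact (T := T)
  have e : (λ_ (T.obj K)).inv ≫ T.η.app (𝟙_ C) ▷ T.obj K ≫ m ≫ coact T (𝟙_ C) =
      (λ_ (T.obj K)).inv ≫ ((ρ_ (𝟙_ C)).inv ≫ (T.η.app (𝟙_ C) ⊗ₘ T.η.app (𝟙_ C))) ▷ T.obj K ≫
        (α_ _ _ _).hom ≫ T.obj (𝟙_ C) ◁ m := by
    rw [← hi, ← comp_whiskerRight_assoc, hu]
  have e' := e =≫ (T.obj (𝟙_ C) ◁ η (T : C ⥤ C) ≫ (ρ_ _).hom)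
  simp only [Category.assoc, reassoc_of% hc, Iso.inv_hom_id, Category.comp_id] at e'
  rw [e', MonoidalCategory.tensorHom_def', form]
  dsimp only [Functor.id_obj]
  simp only [comp_whiskerRight, Category.assoc, associator_naturality_left_assoc,
    ← whisker_exchange_assoc, associator_naturality_middle_assoc, rightUnitor_naturality]
  simp [-left_unitality, unitors_inv_equal]

/-- The mirror argument: (ii) with `T₀` on the left factor, then `LC.form_unit`. -/
theorem LC.coact_form (h : LC T K u m) :
    coact T K ≫ form m ▷ T.obj (𝟙_ C) ≫ (λ_ _).hom = form m ≫ T.η.app (𝟙_ C) := by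
  have hc := coact_one_counit T
  have e := (λ_ (T.obj K)).inv ≫= T.η.app (𝟙_ C) ▷ T.obj K ≫=
    (h.ii =≫ (η (T : C ⥤ C) ▷ T.obj (𝟙_ C) ≫ (λ_ _).hom))
  simp only [Category.assoc, reassoc_of% hc, Iso.inv_hom_id, Category.comp_id] at e
  rw [h.form_unit, ← e, ← whisker_exchange_assoc]
  dsimp only [Functor.id_obj]
  rw [← leftUnitor_inv_naturality_assoc, form]
  simp [-left_unitality]

theorem LC.unit_form (h : LC T K u m) : u ≫ form m = 𝟙 (𝟙_ C) := by
  have h₀ := IsComonoidal.unit_unit (T := T)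
  have h₃ := h.iii
  rw [form, leftUnitor_inv_naturality_assoc, whisker_exchange_assoc, unitors_inv_equal]
  dsimp only [Functor.id_obj] at h₀ ⊢
  rw [← rightUnitor_inv_naturality_assoc, reassoc_of% h₃, h₀]

/-- Coassociativity moves the coaction onto `TK`, where `LC.coact_form` applies. This is the fork
condition for descent, up to an invertible map. -/
theorem LC.contraction_unitFusion (h : LC T K u m) (Y : C) :
    contraction m Y ≫ T.map (T.η.app Y) ≫ unitFusion T (T.μ.app Y) =
      contraction m Y ≫ T.η.app (T.obj Y) ≫ unitFusion T (T.μ.app Y) := by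
  have h₁ := comul_coassoc_one T K Y
  have h₂ := h.coact_form
  rw [map_unit_unitFusion, unit_unitFusion (T.left_unit Y), contraction]
  simp only [Category.assoc, Iso.hom_inv_id_assoc]
  rw [← leftUnitor_naturality, ← whisker_exchange_assoc, reassoc_of% h₁, ← comp_whiskerRight,
    ← h₂]
  simp

/-- Since `m` is `T`-linear, it is recovered from its restriction along `η_𝟙`, which `LC.form_unit`
expresses by the form. -/
theorem LC.map_form (h : LC T K u m)
    (hm : T.map m ≫ T.μ.app (𝟙_ C) =
      tensorAction T (T.μ.app (𝟙_ C)) (T.μ.app K) ≫ m) :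
    T.map (form m) = unitFusion T (T.μ.app K) ≫ m := by
  have h₁ := T.right_unit (𝟙_ C)
  have e : T.map (form m) = T.map (form m ≫ T.η.app (𝟙_ C)) ≫ T.μ.app (𝟙_ C) := by
    rw [Functor.map_comp, Category.assoc, h₁]
    exact (Category.comp_id _).symm
  rw [e, h.form_unit, Functor.map_comp, Functor.map_comp, Category.assoc, Category.assoc, hm,
    tensorAction, Category.assoc, ← δ_natural_left_assoc, MonoidalCategory.tensorHom_def,
    Category.assoc, ← comp_whiskerRight_assoc, h₁, unitFusion, fusion]
  simp

theorem LC.map_contraction (h : LC T K u m)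
    (hm : T.map m ≫ T.μ.app (𝟙_ C) =
      tensorAction T (T.μ.app (𝟙_ C)) (T.μ.app K) ≫ m) (Y : C) :
    T.map (contraction m Y) ≫ T.μ.app Y =
      unitFusion T (T.μ.app (K ⊗ Y)) ≫ T.obj (𝟙_ C) ◁ δ (T : C ⥤ C) K Y ≫
        (α_ _ _ _).inv ≫ (m ≫ η (T : C ⥤ C)) ▷ T.obj Y ≫ (λ_ _).hom := by
  -- Inserting a fusion operator undone by `T₀` lets `T(form)` be replaced by `m`.
  have e : T.μ.app Y = unitFusion T (T.μ.app Y) ≫ η (T : C ⥤ C) ▷ T.obj Y ≫ (λ_ _).hom := by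
    rw [reassoc_of% unitFusion_counit, Iso.inv_hom_id, Category.comp_id]
  have e₁ : T.map (λ_ (T.obj Y)).hom ≫ unitFusion T (T.μ.app Y) =
      fusion T (𝟙_ C) (T.μ.app Y) := by
    rw [unitFusion, ← Functor.map_comp_assoc, Iso.hom_inv_id, CategoryTheory.Functor.map_id, Category.id_comp]
  have e₂ : fusion T (T.obj K) (T.μ.app Y) ≫ unitFusion T (T.μ.app K) ▷ T.obj Y =
      unitFusion T (tensorAction T (T.μ.app K) (T.μ.app Y)) ≫ (α_ _ _ _).inv := by
    rw [unitFusion_tensorAction]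
    simp
  have e₃ := unitFusion_natural (map_comul_tensorAction (T := T) K Y)
  rw [e, contraction, Functor.map_comp, Functor.map_comp, Category.assoc, Category.assoc,
    reassoc_of% e₁, reassoc_of% fusion_natural_left, h.map_form hm, comp_whiskerRight_assoc,
    reassoc_of% e₂, reassoc_of% e₃, comp_whiskerRight_assoc]

end Pairing

/-! ### Unit, counit and triangle identities -/

section Adjunction

variable {T : Monad C} [(T : C ⥤ C).OplaxMonoidal] {K : C}

instance (T : Monad C) [(T : C ⥤ C).OplaxMonoidal] [IsLeftHopf T] (X Y : C) :
    IsIso (fusion T X (T.μ.app Y)) :=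
  IsLeftHopf.isIso_leftFusion X Y

instance (T : Monad C) [(T : C ⥤ C).OplaxMonoidal] [IsLeftHopf T] (Y : C) :
    IsIso (unitFusion T (T.μ.app Y)) := by
  unfold unitFusion; infer_instance

variable [IsLeftHopf T] {u : 𝟙_ C ⟶ T.obj K}
  {m : T.obj (𝟙_ C) ⊗ T.obj K ⟶ T.obj (𝟙_ C)}

theorem LC.exists_evaluation (h : LC T K u m) (hT : IsOfDescentType T) (Y : C) :
    ∃ r : T.obj (K ⊗ Y) ⟶ Y, r ≫ T.η.app Y = contraction m Y := by
  obtain ⟨hl⟩ := hT Y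
  refine ⟨Limits.Fork.IsLimit.lift hl (contraction m Y) ?_,
    Limits.Fork.IsLimit.lift_ι hl⟩
  rw [← cancel_mono (unitFusion T (T.μ.app Y)), Category.assoc, Category.assoc]
  exact h.contraction_unitFusion Y

/-- The map `TX ⟶ TK ⊗ TX ≅ T(K ⊗ TX)` induced by `u : 𝟙 ⟶ TK`. -/
noncomputable def coevaluation (u : 𝟙_ C ⟶ T.obj K) (X : C) : T.obj X ⟶ T.obj (K ⊗ T.obj X) :=
  (λ_ (T.obj X)).inv ≫ u ▷ T.obj X ≫ inv (fusion T K (T.μ.app X))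

theorem coevaluation_fusion (u : 𝟙_ C ⟶ T.obj K) (X : C) :
    coevaluation u X ≫ fusion T K (T.μ.app X) = (λ_ (T.obj X)).inv ≫ u ▷ T.obj X := by
  simp [coevaluation]

/-- Naturality holds for all morphisms of free algebras, not only those of the form `T(g)`; the
second triangle needs it for `μ`. -/
theorem coevaluation_natural (u : 𝟙_ C ⟶ T.obj K) {X Y : C} {f : T.obj X ⟶ T.obj Y}
    (h : T.map f ≫ T.μ.app Y = T.μ.app X ≫ f) :
    f ≫ coevaluation u Y = coevaluation u X ≫ T.map (K ◁ f) := by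
  rw [← cancel_mono (fusion T K (T.μ.app Y)), Category.assoc, Category.assoc, coevaluation_fusion,
    fusion_natural_right _ h, reassoc_of% coevaluation_fusion, ← whisker_exchange,
    leftUnitor_inv_naturality_assoc]

theorem map_coevaluation (u : 𝟙_ C ⟶ T.obj K) (hu : T.map u ≫ T.μ.app K = η (T : C ⥤ C) ≫ u)
    (X : C) :
    T.map (coevaluation u X) ≫ T.μ.app _ = T.μ.app X ≫ coevaluation u X := by
  rw [← cancel_mono (fusion T K (T.μ.app X)), Category.assoc, Category.assoc, coevaluation_fusion]
  have e := map_fusion_tensorAction (T := T) K (T.assoc X)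
  rw [← e, ← Functor.map_comp_assoc, coevaluation_fusion, Functor.map_comp, Category.assoc,
    tensorAction, ← δ_natural_left_assoc, MonoidalCategory.tensorHom_def,
    ← comp_whiskerRight_assoc, hu, comp_whiskerRight_assoc, leftUnitor_inv_naturality_assoc,
    whisker_exchange, left_unitality (F := (T : C ⥤ C)) (T.obj X)]
  simp only [Category.assoc]

theorem LC.coevaluation_contraction (h : LC T K u m) (X : C) :
    coevaluation u X ≫ contraction m (T.obj X) ≫ T.μ.app X = 𝟙 (T.obj X) := by
  have e : contraction m (T.obj X) ≫ T.μ.app X =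
      fusion T K (T.μ.app X) ≫ form m ▷ T.obj X ≫ (λ_ _).hom := by
    rw [contraction, fusion, Category.assoc, Category.assoc, Category.assoc,
      ← leftUnitor_naturality, whisker_exchange_assoc]
  rw [e, reassoc_of% coevaluation_fusion, ← comp_whiskerRight_assoc, h.unit_form]
  simp

/-- The second triangle identity, composed with `T(K ⊗ η_Y)` so that the contraction replaces `r`.
-/
theorem LC.coevaluation_map_contraction (h : LC T K u m)
    (hm : T.map m ≫ T.μ.app (𝟙_ C) =
      tensorAction T (T.μ.app (𝟙_ C)) (T.μ.app K) ≫ m) (Y : C) :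
    T.η.app (T.obj (K ⊗ Y)) ≫ coevaluation u (T.obj (K ⊗ Y)) ≫
      T.map (K ◁ (T.μ.app (K ⊗ Y) ≫ contraction m Y)) = T.map (K ◁ T.η.app Y) := by
  have e := T.left_unit (K ⊗ Y)
  have e₁ := comul_unitFusion K (T.μ.app (K ⊗ Y))
  rw [← cancel_mono (fusion T K (T.μ.app Y)), map_unit_fusion, Category.assoc, Category.assoc,
    MonoidalCategory.whiskerLeft_comp, Functor.map_comp, ← Category.assoc (coevaluation u _),
    ← Category.assoc (coevaluation u _), ← coevaluation_natural u (T.assoc _), Category.assoc, Category.assoc,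
    reassoc_of% e, fusion, ← δ_natural_right_assoc, ← MonoidalCategory.whiskerLeft_comp,
    h.map_contraction hm, MonoidalCategory.whiskerLeft_comp, reassoc_of% e₁,
    reassoc_of% coevaluation_fusion, h.tensor_coact_form]

theorem LC.nonempty_adjunction (h : LC T K u m)
    (hu : T.map u ≫ T.μ.app K = η (T : C ⥤ C) ≫ u)
    (hm : T.map m ≫ T.μ.app (𝟙_ C) =
      tensorAction T (T.μ.app (𝟙_ C)) (T.μ.app K) ≫ m)
    (hT : IsOfDescentType T) (hmono : ∀ X : C, Mono (T.map (K ◁ T.η.app X))) :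
    Nonempty ((T : C ⥤ C) ⊣ tensorLeft K ⋙ (T : C ⥤ C)) := by
  choose r hr using h.exists_evaluation hT
  have hη (X : C) : Mono (T.η.app X) := by
    obtain ⟨hl⟩ := hT X
    exact Limits.mono_of_isLimit_fork hl
  refine ⟨Adjunction.mkOfUnitCounit
    { unit := { app X := T.η.app X ≫ coevaluation u X, naturality X Y f := ?_ }
      counit := { app Y := T.μ.app (K ⊗ Y) ≫ r Y, naturality X Y f := ?_ }
      left_triangle := ?_
      right_triangle := ?_ }⟩
  · have e := T.η.naturality f
    have e' := coevaluation_natural u (T.μ.naturality f)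
    dsimp at e e' ⊢
    rw [reassoc_of% e, e', Category.assoc]
  · have e := T.μ.naturality (K ◁ f)
    have e' := T.η.naturality f
    have e₁ : T.map (K ◁ f) ≫ r Y = r X ≫ f := by
      -- `r` is known only through `r ≫ η`, so its naturality is inherited from the contraction.
      refine (cancel_mono (T.η.app Y)).1 ?_
      have e₂ : r X ≫ f ≫ T.η.app Y = r X ≫ T.η.app X ≫ T.map f := congrArg (r X ≫ ·) e'
      dsimp only [Functor.id_obj]
      rw [Category.assoc, Category.assoc, hr, contraction_natural, ← hr, Category.assoc]
      exact e₂.symm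
    dsimp at e ⊢
    rw [reassoc_of% e, Category.assoc, e₁]
  · ext X
    have e := T.right_unit X
    have e₁ := h.coevaluation_contraction X
    have e₂ := T.left_unit X
    have e₃ := map_coevaluation u hu X
    -- Here `η` and `μ` cancel, leaving an identity about `r` itself.
    rw [← hr, Category.assoc, e₂] at e₁
    dsimp at e e₁ e₃ ⊢
    simp only [Functor.map_comp, Category.assoc, Category.id_comp, Category.comp_id] at e₁ ⊢
    rw [reassoc_of% e₃, reassoc_of% e, e₁]
  · ext Y
    have e := h.coevaluation_map_contraction hm Y
    have := hmono Y
    rw [← cancel_mono (T.map (K ◁ T.η.app Y))]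
    dsimp at e ⊢
    simp only [Category.id_comp, Category.assoc, ← Functor.map_comp,
      ← MonoidalCategory.whiskerLeft_comp, hr]
    exact e

end Adjunction

end HopfMonad

open CategoryTheory MonoidalCategory in
theorem mainTheorem5 {C : Type*} [Category* C] [MonoidalCategory C]
    (T : Monad C) [(T : C ⥤ C).OplaxMonoidal] [HopfMonad.IsLeftHopf T]
    (K : C)
    (u : HopfMonad.unitAlgebra T ⟶ T.free.obj K)
    (m : HopfMonad.tensorAlgebra (T.free.obj (𝟙_ C)) (T.free.obj K) ⟶ T.free.obj (𝟙_ C))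
    (hLC : HopfMonad.LC T K u.f m.f)
    (hdescent : HopfMonad.IsOfDescentType T)
    (hmono : ∀ X : C, Mono (T.map (K ◁ T.η.app X))) :
    Nonempty ((T : C ⥤ C) ⊣ tensorLeft K ⋙ (T : C ⥤ C)) := by
  exact hLC.nonempty_adjunction u.h m.h hdescent hmono
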